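/- Let $H$ be a real separable Hilbert space and let $K\subset H$ be a closed convex cone (nonempty, stable under addition and under multiplication by all $t\ge 0$) which is pointed ($K\cap(-K)=\{0\}$), generating ($K-K=H$) and normal (if $x_n\in K$, $x_n\to 0$ and $0\le y_n\le x_n$, then $y_n\to 0$), where $x\le y$ means $y-x\in K$. Let $P:H\to K$ be the metric projection, $Px=\operatorname{argmin}\{\|x-y\|:y\in K\}$, and let $I$ be the identity map. Definitions. For a closed pointed convex cone $C\subset H$ with its order $u\le_C v\iff v-u\in C$, a retraction onto $C$ is a map $Q:H\to H$ with $Q\circ Q=Q$ and $Q(H)=C$. A continuous map $Q:H\to H$ is an asymmetric vector norm (aVn) with cone range $C$ if it is a retraction onto $C$, $Q(tx)=tQx$ for all $t\ge0$, $x \in H$, $Q(x+y)\le_C Qx+Qy$ for all $x,y$, and $Qx=Q(-x)=0$ implies $x=0$. It is proper if moreover $Q(x-Qx)=0$ for all $x$. The cone $K$ is a lattice cone if $x\vee y=\sup\{x,y\}$ exists in $(H,\le)$ for all $x,y\in H$; then $x^+=0\vee x$, $x^-=0\vee(-x)$ and $|x|=x^++x^-$. $H$ ordered by $K$ is a Hilbert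 vector lattice if $K$ is a lattice cone, $\||x|\|=\|x\|$ for all $x$, and $0\le x\le y$ implies $\|x\|\le\|y\|$. $K$ is self-dual if $K=\{x\in H:\langle x,y\rangle\ge 0\ \forall y\in K\}$. Theorem. The following assertions are equivalent: 1. $P$ is a proper aVn with cone range $K$, and $I-P$ is a proper aVn with respect to its own cone range $(I-P)(H)$; 2. $P$ is a retraction onto $K$ that is subadditive ($P(x+y)\le Px+Py$ for all $x,y$) and isotone ($x\le y$ implies $Px\le Py$); 3. $H$ ordered by $K$ is a Hilbert vector lattice; 4. $K$ is self-dual and a lattice cone; 5. $K$ is a lattice cone and $Px=x^+$ for all $x\in H$. If moreover $\dim H=m$ is finite, these assertions are also equivalent to 6. there are linearly independent vectors $x_1,\dots,x_m\in H$ with $\langle x_i,x_j\rangle=0$ whenever $i\ne j$ such that $K=\{t^1x_1+\dots+t^mx_m:\ t^i\ge 0,\ i=1,\dots,m\}$. -/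

import Mathlib

open scoped RealInnerProductSpace

/-! In Mathlib a `PointedCone ℝ X` is a nonempty convex cone stable under multiplication by all
`t ≥ 0` (it contains `0`); the condition `K ∩ (-K) = {0}` is `ConvexCone.Salient`, and
`K - K = X` is `ConvexCone.IsReproducing`. -/

namespace ConeOrdered

section Order

variable {X : Type*} [AddCommGroup X] [Module ℝ X]

/-- The relation `x ≤ y` induced by the cone `K`. -/
def ConeLE (K : PointedCone ℝ X) (x y : X) : Prop := y - x ∈ K

/-- `s` is the supremum of `x` and `y` for the order induced by `K`. -/
def IsSup (K : PointedCone ℝ X) (x y s : X) : Prop :=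
  ConeLE K x s ∧ ConeLE K y s ∧ ∀ w : X, ConeLE K x w → ConeLE K y w → ConeLE K s w

/-- `K` induces an order relation for which any two elements have a supremum. -/
structure IsLatticeCone (K : PointedCone ℝ X) : Prop where
  salient : (K : ConvexCone ℝ X).Salient
  exists_sup : ∀ x y : X, ∃ s : X, IsSup K x y s

/-- `R` is isotone for the order induced by `K`. -/
def Isotone (K : PointedCone ℝ X) (R : X → X) : Prop :=
  ∀ x y : X, ConeLE K x y → ConeLE K (R x) (R y)

/-- `R` is subadditive for the order induced by `K`. -/
def Subadditive (K : PointedCone ℝ X) (R : X → X) : Prop :=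
  ∀ x y : X, ConeLE K (R (x + y)) (R x + R y)

/-- `R` is a retraction of `X` onto `K`. -/
structure IsRetractionOnto (K : PointedCone ℝ X) (R : X → X) : Prop where
  idem : ∀ x : X, R (R x) = R x
  range_eq : Set.range R = (K : Set X)

open Classical in
/-- The positive part `x⁺ = sup {0, x}`; only meaningful when `K` is a lattice cone. -/
noncomputable def posPart (K : PointedCone ℝ X) (x : X) : X :=
  if h : ∃ s : X, IsSup K 0 x s then h.choose else 0

/-- The absolute value `|x| = x⁺ + x⁻`, where `x⁻ = (-x)⁺`. -/
noncomputable def absVal (K : PointedCone ℝ X) (x : X) : X :=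
  posPart K x + posPart K (-x)

theorem posPart_isSup {K : PointedCone ℝ X} (hK : IsLatticeCone K) (x : X) :
    IsSup K 0 x (posPart K x) := by
  have h := hK.exists_sup 0 x
  unfold posPart
  rw [dif_pos h]
  exact h.choose_spec

/-- A supremum is unique when `K` is salient. -/
theorem IsSup.unique {K : PointedCone ℝ X} (hK : (K : ConvexCone ℝ X).Salient) {x y s t : X}
    (hs : IsSup K x y s) (ht : IsSup K x y t) : s = t := by
  have h1 : t - s ∈ K := hs.2.2 t ht.1 ht.2.1
  have h2 : s - t ∈ K := ht.2.2 s hs.1 hs.2.1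
  by_contra hne
  exact hK (t - s) h1 (sub_ne_zero.2 (Ne.symm hne)) (by rw [neg_sub]; exact h2)

end Order

section Topological

variable {X : Type*} [AddCommGroup X] [Module ℝ X] [TopologicalSpace X]

/-- `Q` is an asymmetric vector norm (aVn) on the topological vector space `X` with cone range
`K`. The cone `K` is closed and induces an order relation, and `Q` is continuous. -/
structure IsAVn (K : PointedCone ℝ X) (Q : X → X) : Prop where
  salient : (K : ConvexCone ℝ X).Salient
  closed : IsClosed (K : Set X)
  continuous : Continuous Q
  retraction : IsRetractionOnto K Q
  pos_homogeneous : ∀ (t : ℝ) (x : X), 0 ≤ t → Q (t • x) = t • Q x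
  subadditive : Subadditive K Q
  eq_zero : ∀ x : X, Q x = 0 → Q (-x) = 0 → x = 0

/-- `Q` is a proper aVn with cone range `K`: an aVn with `Q ∘ (I - Q) = 0`. -/
structure IsProperAVn (K : PointedCone ℝ X) (Q : X → X) : Prop extends IsAVn K Q where
  proper : ∀ x : X, Q (x - Q x) = 0

/-- `K` is a normal cone: it is closed, salient, and `0 ≤ yₙ ≤ xₙ → 0` forces `yₙ → 0`. -/
structure IsNormalCone (K : PointedCone ℝ X) : Prop where
  closed : IsClosed (K : Set X)
  salient : (K : ConvexCone ℝ X).Salient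
  normal : ∀ x y : ℕ → X, (∀ n, x n ∈ K) → Filter.Tendsto x Filter.atTop (nhds 0) →
    (∀ n, ConeLE K 0 (y n) ∧ ConeLE K (y n) (x n)) → Filter.Tendsto y Filter.atTop (nhds 0)

end Topological

section Hilbert

variable {H : Type*} [NormedAddCommGroup H] [InnerProductSpace ℝ H]

/-- `p` is a point of `K` nearest to `x`. -/
def IsNearest (K : PointedCone ℝ H) (x p : H) : Prop :=
  p ∈ K ∧ ∀ y ∈ K, ‖x - p‖ ≤ ‖x - y‖

open Classical in
/-- The metric projection onto `K`, `P x = argmin {‖x - y‖ : y ∈ K}`. For a closed cone of a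
Hilbert space the nearest point exists and is unique, see the two facts below. -/
noncomputable def metricProj (K : PointedCone ℝ H) (x : H) : H :=
  if h : ∃ p : H, IsNearest K x p then h.choose else 0

theorem metricProj_isNearest [CompleteSpace H] {K : PointedCone ℝ H}
    (hK : IsClosed (K : Set H)) (x : H) : IsNearest K x (metricProj K x) := by
  have h : ∃ p : H, IsNearest K x p := by
    obtain ⟨p, hp, hmin⟩ := exists_norm_eq_iInf_of_complete_convex
      (K := (K : Set H)) ⟨0, K.zero_mem⟩ hK.isComplete K.convex x
    refine ⟨p, hp, fun y hy => ?_⟩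
    rw [hmin]
    exact ciInf_le (f := fun w : (K : Set H) => ‖x - w‖)
      ⟨0, Set.forall_mem_range.2 fun _ => norm_nonneg _⟩ ⟨y, hy⟩
  unfold metricProj
  rw [dif_pos h]
  exact h.choose_spec

theorem IsNearest.inner_le {K : PointedCone ℝ H} {x p : H} (hp : IsNearest K x p) :
    ∀ y ∈ K, ⟪x - p, y - p⟫ ≤ 0 := by
  have hne : Nonempty (K : Set H) := ⟨⟨p, hp.1⟩⟩
  refine (norm_eq_iInf_iff_real_inner_le_zero (K := (K : Set H)) K.convex hp.1).1 ?_
  refine le_antisymm (le_ciInf fun w => hp.2 w w.2) ?_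
  exact ciInf_le (f := fun w : (K : Set H) => ‖x - w‖)
      ⟨0, Set.forall_mem_range.2 fun _ => norm_nonneg _⟩ ⟨p, hp.1⟩

theorem IsNearest.unique {K : PointedCone ℝ H} {x p q : H}
    (hp : IsNearest K x p) (hq : IsNearest K x q) : p = q := by
  have h1 := hp.inner_le q hq.1
  have h2 := hq.inner_le p hp.1
  have h3 : ⟪q - p, q - p⟫ = ⟪x - p, q - p⟫ + ⟪x - q, p - q⟫ := by
    simp only [inner_sub_left, inner_sub_right]
    ring
  have h4 : ⟪q - p, q - p⟫ = 0 := le_antisymm (by linarith) real_inner_self_nonneg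
  exact (sub_eq_zero.1 (inner_self_eq_zero.1 h4)).symm

/-- `H`, ordered by `K`, is a Hilbert vector lattice. -/
structure IsHilbertVectorLattice (K : PointedCone ℝ H) : Prop where
  lattice : IsLatticeCone K
  norm_absVal : ∀ x : H, ‖absVal K x‖ = ‖x‖
  norm_mono : ∀ x y : H, ConeLE K 0 x → ConeLE K x y → ‖x‖ ≤ ‖y‖

/-- `K` equals its dual cone `{x | ∀ y ∈ K, 0 ≤ ⟪x, y⟫}`. -/
def IsSelfDual [CompleteSpace H] (K : PointedCone ℝ H) : Prop :=
  (K : Set H) = (ProperCone.innerDual (K : Set H) : Set H)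

/-- `K` is the set of nonnegative combinations of `m` linearly independent, mutually orthogonal
vectors. -/
def IsOrthogonallyGenerated (K : PointedCone ℝ H) (m : ℕ) : Prop :=
  ∃ v : Fin m → H, LinearIndependent ℝ v ∧ (∀ i j, i ≠ j → ⟪v i, v j⟫ = 0) ∧
    (K : Set H) = {z | ∃ t : Fin m → ℝ, (∀ i, 0 ≤ t i) ∧ z = ∑ i, t i • v i}

end Hilbert

end ConeOrdered

/-! Assertion 4 is the hub. By Moreau's decomposition, `P x` lies in K, `P x - x` lies in the dual
cone K*, and the two are orthogonal. If K = K*, both lie in K, and orthogonal elements of K have no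
nonzero common minorant in K. In a lattice cone they are therefore x⁺ and x⁻
(`IsSelfDual.metricProj_eq_posPart`), which yields 1, 3 and 5.

Conversely, subadditivity of P on a generating cone gives K* ⊆ K (`mem_of_subadditive`). The
inclusion K ⊆ K* comes from isotonicity in 2, and in 1 from subadditivity of I - P and the density
of K* - K* (`inner_nonneg_of_subadditive_polar`). From 3, self-duality follows by comparing ‖x - y‖
with ‖x + y‖; from 5, by the identity P(-x) = P x - x.

In finite dimension, take an orthogonal set in K of largest size. Its members generate extreme rays,
and removing from an element of K its projections on them never leaves K. The final remainder is
orthogonal to the whole set, hence zero. -/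

namespace ConeOrdered

variable {H : Type*} [NormedAddCommGroup H] [InnerProductSpace ℝ H]

/-! ### Positive parts in a lattice cone -/

section Lattice

variable {X : Type*} [AddCommGroup X] [Module ℝ X] {K : PointedCone ℝ X}

theorem posPart_mem (hK : IsLatticeCone K) (x : X) : posPart K x ∈ K := by
  simpa [ConeLE] using (posPart_isSup hK x).1

theorem posPart_sub_mem (hK : IsLatticeCone K) (x : X) : posPart K x - x ∈ K :=
  (posPart_isSup hK x).2.1

theorem sub_posPart_mem (hK : IsLatticeCone K) {x u : X} (hu : u ∈ K) (hux : u - x ∈ K) :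
    u - posPart K x ∈ K :=
  (posPart_isSup hK x).2.2 u (by simpa [ConeLE] using hu) hux

theorem eq_of_sub_mem (hK : (K : ConvexCone ℝ X).Salient) {x y : X} (h₁ : x - y ∈ K)
    (h₂ : y - x ∈ K) : x = y := by
  by_contra hne
  exact hK (x - y) h₁ (sub_ne_zero.2 hne) (by rw [neg_sub]; exact h₂)

/-- Translation by x carries the upper bounds of 0 and -x to those of x and 0. -/
theorem posPart_neg (hK : IsLatticeCone K) (x : X) : posPart K (-x) = posPart K x - x := by
  refine eq_of_sub_mem hK.salient ?_ ?_
  · have h := sub_posPart_mem hK (x := x) (u := posPart K (-x) + x)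
      (by simpa using posPart_sub_mem hK (-x)) (by simpa using posPart_mem hK (-x))
    convert h using 1
    abel
  · exact sub_posPart_mem hK (posPart_sub_mem hK x) (by simpa using posPart_mem hK x)

theorem posPart_subadditive (hK : IsLatticeCone K) : Subadditive K (posPart K) := by
  intro x y
  refine sub_posPart_mem hK (K.add_mem (posPart_mem hK x) (posPart_mem hK y)) ?_
  convert K.add_mem (posPart_sub_mem hK x) (posPart_sub_mem hK y) using 1
  abel

/-- A salient cone is a lattice cone as soon as each `sup {0, x}` exists. -/
theorem isLatticeCone_of_isSup_zero (hK : (K : ConvexCone ℝ X).Salient) {R : X → X}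
    (hR : ∀ x, IsSup K 0 x (R x)) : IsLatticeCone K := by
  refine ⟨hK, fun x y => ⟨x + R (y - x), ?_, ?_, fun w hxw hyw => ?_⟩⟩
  · simpa [ConeLE] using (hR (y - x)).1
  · have h := (hR (y - x)).2.1
    unfold ConeLE at *
    convert h using 1
    abel
  · have h := (hR (y - x)).2.2 (w - x) (by simpa [ConeLE] using hxw)
      (by simpa [ConeLE] using hyw)
    unfold ConeLE at *
    convert h using 1
    abel

end Lattice

/-! ### Metric projection and Moreau's decomposition -/

section Moreau

variable {K : PointedCone ℝ H}

/-- Since |x| and x are the sum and the difference of x⁺ and x⁻, equality of their norms is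
orthogonality of the two parts. -/
theorem IsHilbertVectorLattice.inner_posPart (hK : IsHilbertVectorLattice K) (x : H) :
    ⟪posPart K x, posPart K x - x⟫ = 0 := by
  have h := hK.norm_absVal x
  unfold absVal at h
  rw [posPart_neg hK.lattice] at h
  have h₁ := norm_add_sq_real (posPart K x) (posPart K x - x)
  have h₂ := norm_sub_sq_real (posPart K x) (posPart K x - x)
  rw [sub_sub_cancel] at h₂
  rw [h] at h₁
  linarith

/-- Conjugating a proper aVn by `x ↦ -x` gives a proper aVn onto the opposite cone. -/
theorem IsProperAVn.neg {Q : H → H} (hQ : IsProperAVn K Q) :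
    IsProperAVn (K.comap (-LinearMap.id)) fun x => -Q (-x) where
  salient x hx hne hneg := hQ.salient (-x) (by simpa using hx) (neg_ne_zero.2 hne)
    (by simpa using hneg)
  closed := hQ.closed.preimage continuous_neg
  continuous := (hQ.continuous.comp continuous_neg).neg
  retraction := by
    refine ⟨fun x => by simp [hQ.retraction.idem], ?_⟩
    ext x
    have h := Set.ext_iff.1 hQ.retraction.range_eq (-x)
    simp only [Set.mem_range, SetLike.mem_coe] at h
    simp only [Set.mem_range, SetLike.mem_coe, PointedCone.mem_comap, LinearMap.neg_apply,
      LinearMap.id_apply]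
    rw [← h]
    constructor
    · rintro ⟨y, rfl⟩
      exact ⟨-y, by simp⟩
    · rintro ⟨y, hy⟩
      exact ⟨-y, by simp [hy]⟩
  pos_homogeneous t x ht := by
    rw [← smul_neg, hQ.pos_homogeneous t _ ht, smul_neg]
  subadditive x y := by
    have h := hQ.subadditive (-x) (-y)
    unfold ConeLE at *
    simp only [PointedCone.mem_comap, LinearMap.neg_apply, LinearMap.id_apply]
    rw [neg_add]
    convert h using 1
    abel
  eq_zero x h₁ h₂ := hQ.eq_zero x (by simpa using h₂) (by simpa using h₁)
  proper x := by
    have h := hQ.proper (-x)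
    rw [neg_eq_zero]
    convert h using 2
    abel

/-- Variational characterization of the nearest point of a cone. -/
theorem isNearest_of_inner {x p : H} (hp : p ∈ K) (horth : ⟪x - p, p⟫ = 0)
    (hpolar : ∀ y ∈ K, ⟪x - p, y⟫ ≤ 0) : IsNearest K x p := by
  refine ⟨hp, fun y hy => ?_⟩
  have h : ‖x - y‖ ^ 2 = ‖x - p‖ ^ 2 + 2 * (⟪x - p, p⟫ - ⟪x - p, y⟫) + ‖p - y‖ ^ 2 := by
    rw [← inner_sub_right, ← norm_add_sq_real]
    congr 2
    abel
  refine le_of_sq_le_sq ?_ (norm_nonneg _)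
  nlinarith [hpolar y hy, sq_nonneg ‖p - y‖]

variable [CompleteSpace H]

theorem metricProj_mem (hK : IsClosed (K : Set H)) (x : H) : metricProj K x ∈ K :=
  (metricProj_isNearest hK x).1

theorem metricProj_eq (hK : IsClosed (K : Set H)) {x p : H} (hp : p ∈ K)
    (horth : ⟪x - p, p⟫ = 0) (hpolar : ∀ y ∈ K, ⟪x - p, y⟫ ≤ 0) : metricProj K x = p :=
  (metricProj_isNearest hK x).unique (isNearest_of_inner hp horth hpolar)

theorem inner_sub_metricProj_self (hK : IsClosed (K : Set H)) (x : H) :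
    ⟪x - metricProj K x, metricProj K x⟫ = 0 := by
  have hp := metricProj_isNearest hK x
  -- Testing against 0 and 2p, the two directions of the ray through p, gives both inequalities.
  have h₀ := hp.inner_le 0 K.zero_mem
  have h₂ := hp.inner_le _ (K.add_mem hp.1 hp.1)
  simp only [zero_sub, inner_neg_right, add_sub_cancel_right] at h₀ h₂
  linarith

theorem inner_sub_metricProj_le (hK : IsClosed (K : Set H)) (x : H) {y : H} (hy : y ∈ K) :
    ⟪x - metricProj K x, y⟫ ≤ 0 := by
  have h := (metricProj_isNearest hK x).inner_le y hy
  rw [inner_sub_right, inner_sub_metricProj_self hK] at h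
  linarith

theorem metricProj_of_mem (hK : IsClosed (K : Set H)) {x : H} (hx : x ∈ K) :
    metricProj K x = x :=
  metricProj_eq hK hx (by simp) (by simp)

/-- The zero set of P is the polar cone; this turns order properties of P into statements about
duality. -/
theorem metricProj_eq_zero_iff (hK : IsClosed (K : Set H)) {x : H} :
    metricProj K x = 0 ↔ ∀ y ∈ K, ⟪x, y⟫ ≤ 0 := by
  refine ⟨fun h y hy => ?_, fun h => metricProj_eq hK K.zero_mem (by simp) (by simpa using h)⟩
  simpa [h] using inner_sub_metricProj_le hK x hy

theorem metricProj_sub_self (hK : IsClosed (K : Set H)) (x : H) :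
    metricProj K (x - metricProj K x) = 0 :=
  (metricProj_eq_zero_iff hK).2 fun _ => inner_sub_metricProj_le hK x

theorem metricProj_isRetractionOnto (hK : IsClosed (K : Set H)) :
    IsRetractionOnto K (metricProj K) := by
  refine ⟨fun x => metricProj_of_mem hK (metricProj_mem hK x), Set.Subset.antisymm ?_ ?_⟩
  · rintro _ ⟨x, rfl⟩
    exact metricProj_mem hK x
  · exact fun x hx => ⟨x, metricProj_of_mem hK hx⟩

theorem metricProj_smul (hK : IsClosed (K : Set H)) {t : ℝ} (ht : 0 ≤ t) (x : H) :
    metricProj K (t • x) = t • metricProj K x := by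
  refine metricProj_eq hK (K.smul_mem ht (metricProj_mem hK x)) ?_ fun y hy => ?_
  · rw [← smul_sub, inner_smul_left, inner_smul_right, inner_sub_metricProj_self hK]
    simp
  · rw [← smul_sub, real_inner_smul_left]
    exact mul_nonpos_of_nonneg_of_nonpos ht (inner_sub_metricProj_le hK x hy)

/-- Adding the two variational inequalities gives ‖p - q‖² ≤ ⟪x - y, p - q⟫, and Cauchy–Schwarz
makes P nonexpansive. -/
theorem continuous_metricProj (hK : IsClosed (K : Set H)) : Continuous (metricProj K) := by
  refine (LipschitzWith.of_dist_le_mul (K := 1) fun x y => ?_).continuous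
  rw [dist_eq_norm, dist_eq_norm, NNReal.coe_one, one_mul]
  set p := metricProj K x with hp
  set q := metricProj K y with hq
  have h₁ := (metricProj_isNearest hK x).inner_le q (metricProj_mem hK y)
  have h₂ := (metricProj_isNearest hK y).inner_le p (metricProj_mem hK x)
  rw [← hp] at h₁
  rw [← hq] at h₂
  have h₃ : ‖p - q‖ * ‖p - q‖ ≤ ⟪x - y, p - q⟫ := by
    rw [← real_inner_self_eq_norm_mul_norm]
    simp only [inner_sub_left, inner_sub_right] at *
    linarith
  have h₄ := real_inner_le_norm (x - y) (p - q)
  by_contra! hlt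
  nlinarith [norm_nonneg (x - y), norm_nonneg (p - q)]

end Moreau

/-! ### Self-dual lattice cones and Hilbert vector lattices -/

section SelfDual

variable [CompleteSpace H] {K : PointedCone ℝ H}

theorem isSelfDual_iff : IsSelfDual K ↔ ∀ x, x ∈ K ↔ ∀ y ∈ K, 0 ≤ ⟪x, y⟫ := by
  unfold IsSelfDual
  rw [Set.ext_iff]
  refine forall_congr' fun x => ?_
  simp only [SetLike.mem_coe, ProperCone.mem_innerDual]
  refine iff_congr Iff.rfl ⟨fun h y hy => ?_, fun h y hy => ?_⟩
  · rw [real_inner_comm]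
    exact h hy
  · rw [real_inner_comm]
    exact h y hy

theorem IsSelfDual.inner_nonneg (hK : IsSelfDual K) {x y : H} (hx : x ∈ K) (hy : y ∈ K) :
    0 ≤ ⟪x, y⟫ :=
  (isSelfDual_iff.1 hK x).1 hx y hy

theorem IsSelfDual.isClosed (hK : IsSelfDual K) : IsClosed (K : Set H) := by
  rw [hK]
  exact (ProperCone.innerDual (K : Set H)).isClosed

/-- An element of a self-dual cone dominated by two orthogonal elements vanishes. -/
theorem IsSelfDual.eq_zero_of_le (hK : IsSelfDual K) {u p q : H} (hu : u ∈ K) (hp : p ∈ K)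
    (hup : p - u ∈ K) (huq : q - u ∈ K) (hpq : ⟪p, q⟫ = 0) : u = 0 := by
  -- The chain is ⟪u, u⟫ ≤ ⟪p, u⟫ ≤ ⟪p, q⟫ = 0.
  have h₁ := hK.inner_nonneg hup hu
  have h₂ := hK.inner_nonneg hp huq
  rw [inner_sub_left] at h₁
  rw [inner_sub_right] at h₂
  have h₃ : ⟪u, u⟫ ≤ 0 := by linarith
  exact real_inner_self_nonpos.1 h₃

theorem IsSelfDual.metricProj_sub_mem (hK : IsSelfDual K) (x : H) : metricProj K x - x ∈ K := by
  refine (isSelfDual_iff.1 hK _).2 fun y hy => ?_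
  rw [← neg_sub, inner_neg_left]
  linarith [inner_sub_metricProj_le hK.isClosed x hy]

/-- `P x` is an upper bound of 0 and x, so `P x - x⁺` is in K. It is dominated by `P x` because x⁺ ≥
0 and by `P x - x` because x⁺ ≥ x, and these two are orthogonal. -/
theorem IsSelfDual.metricProj_eq_posPart (hK : IsSelfDual K) (hL : IsLatticeCone K) :
    metricProj K = posPart K := by
  funext x
  have hc := hK.isClosed
  have hp := metricProj_mem hc x
  have hq := hK.metricProj_sub_mem x
  refine sub_eq_zero.1 (hK.eq_zero_of_le (sub_posPart_mem hL hp hq) hp (q := metricProj K x - x)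
    ?_ ?_ ?_)
  · simpa using posPart_mem hL x
  · simpa using posPart_sub_mem hL x
  · rw [real_inner_comm, ← neg_sub, inner_neg_left, inner_sub_metricProj_self hc, neg_zero]

/-- Because P(-x) = P x - x, membership of x in K, that is P x = x, amounts to P(-x) = 0, that is to
-x being polar. -/
theorem isSelfDual_of_metricProj_eq_posPart (hc : IsClosed (K : Set H)) (hL : IsLatticeCone K)
    (h : metricProj K = posPart K) : IsSelfDual K := by
  have hneg : ∀ x, metricProj K (-x) = metricProj K x - x := by
    rw [h]
    exact posPart_neg hL
  refine isSelfDual_iff.2 fun x => ⟨fun hx y hy => ?_, fun hx => ?_⟩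
  · have h₁ : metricProj K (-x) = 0 := by rw [hneg, metricProj_of_mem hc hx, sub_self]
    have h₂ := (metricProj_eq_zero_iff hc).1 h₁ y hy
    rw [inner_neg_left] at h₂
    linarith
  · have h₁ : metricProj K (-x) = 0 := (metricProj_eq_zero_iff hc).2 fun y hy => by
      rw [inner_neg_left]
      linarith [hx y hy]
    rw [hneg, sub_eq_zero] at h₁
    rw [← h₁]
    exact metricProj_mem hc x

/-- In a self-dual lattice cone the positive and negative parts are orthogonal. -/
theorem IsSelfDual.inner_posPart (hK : IsSelfDual K) (hL : IsLatticeCone K) (x : H) :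
    ⟪posPart K x, posPart K x - x⟫ = 0 := by
  rw [← hK.metricProj_eq_posPart hL, real_inner_comm, ← neg_sub, inner_neg_left,
    inner_sub_metricProj_self hK.isClosed, neg_zero]

theorem IsSelfDual.isHilbertVectorLattice (hK : IsSelfDual K) (hL : IsLatticeCone K) :
    IsHilbertVectorLattice K := by
  refine ⟨hL, fun x => ?_, fun x y hx hxy => ?_⟩
  · have h₀ := hK.inner_posPart hL x
    unfold absVal
    rw [posPart_neg hL, ← norm_sub_eq_norm_add (by rwa [real_inner_comm] at h₀)]
    simp
  · simp only [ConeLE, sub_zero] at hx hxy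
    have h₁ := hK.inner_nonneg hxy hx
    rw [inner_sub_left, real_inner_self_eq_norm_mul_norm] at h₁
    have h₂ := real_inner_le_norm y x
    by_contra! hlt
    nlinarith [norm_nonneg x, norm_nonneg y]

theorem IsHilbertVectorLattice.isSelfDual (hK : IsHilbertVectorLattice K) : IsSelfDual K := by
  have hL := hK.lattice
  refine isSelfDual_iff.2 fun x => ⟨fun hx y hy => ?_, fun hx => ?_⟩
  -- For x and y in K, (x - y)⁺ ≤ x and (x - y)⁻ ≤ y, so |x - y| ≤ x + y; expanding the squared
  -- norms gives ⟪x, y⟫ ≥ 0.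
  · have hle : ‖x - y‖ ≤ ‖x + y‖ := by
      rw [← hK.norm_absVal (x - y)]
      refine hK.norm_mono _ _ ?_ ?_
      · simpa [ConeLE, absVal] using K.add_mem (posPart_mem hL (x - y)) (posPart_mem hL (-(x - y)))
      · have h₁ := sub_posPart_mem hL (x := x - y) hx (by simpa using hy)
        have h₂ := sub_posPart_mem hL (x := -(x - y)) hy (by simpa using hx)
        unfold ConeLE absVal
        convert K.add_mem h₁ h₂ using 1
        abel
    have h₁ := norm_add_sq_real x y
    have h₂ := norm_sub_sq_real x y
    nlinarith [norm_nonneg (x - y)]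
  -- Pairing x with x⁻ gives -‖x⁻‖² because x⁺ ⊥ x⁻, so x⁻ = 0.
  · have h₁ := hx (posPart K x - x) (posPart_sub_mem hL x)
    have h₂ := hK.inner_posPart x
    have h₃ : ⟪posPart K x - x, posPart K x - x⟫ ≤ 0 := by
      rw [inner_sub_left]
      linarith
    rw [← sub_eq_zero.1 (real_inner_self_nonpos.1 h₃)]
    exact posPart_mem hL x

end SelfDual

/-! ### Order properties of the projection and self-duality -/

section Projection

variable [CompleteSpace H] {K : PointedCone ℝ H}

/-- If the projection onto a generating cone is subadditive, the cone contains its dual. -/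
theorem mem_of_subadditive (hc : IsClosed (K : Set H))
    (hgen : (K : ConvexCone ℝ H).IsReproducing) (hsub : Subadditive K (metricProj K)) {w : H}
    (hw : ∀ y ∈ K, 0 ≤ ⟪w, y⟫) : w ∈ K := by
  have hw' : w ∈ (Set.univ : Set H) := Set.mem_univ w
  rw [← hgen.sub_eq_univ] at hw'
  obtain ⟨a, ha, b, hb, rfl⟩ := hw'
  have h₁ : metricProj K (-(a - b)) = 0 := (metricProj_eq_zero_iff hc).2 fun y hy => by
    rw [inner_neg_left]
    linarith [hw y hy]
  -- With w = a - b this reads b = P b ≤ P a + P(-w) = a.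
  have h₂ := hsub a (-(a - b))
  unfold ConeLE at h₂
  rw [h₁, metricProj_of_mem hc ha, neg_sub, add_sub_cancel, metricProj_of_mem hc hb,
    add_zero] at h₂
  exact h₂

theorem isSelfDual_of_subadditive_of_isotone (hc : IsClosed (K : Set H))
    (hgen : (K : ConvexCone ℝ H).IsReproducing) (hsub : Subadditive K (metricProj K))
    (hsal : (K : ConvexCone ℝ H).Salient) (hiso : Isotone K (metricProj K)) :
    IsSelfDual K := by
  refine isSelfDual_iff.2 fun x => ⟨fun hx y hy => ?_, mem_of_subadditive hc hgen hsub⟩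
  have h₁ := hiso (-x) 0 (by simpa [ConeLE] using hx)
  have h₂ : metricProj K (-x) = 0 := by
    refine eq_of_sub_mem hsal (by simpa using metricProj_mem hc (-x)) ?_
    simpa [ConeLE, metricProj_of_mem hc K.zero_mem] using h₁
  have h₃ := (metricProj_eq_zero_iff hc).1 h₂ y hy
  rw [inner_neg_left] at h₃
  linarith

theorem IsSelfDual.isLatticeCone_of_isotone (hK : IsSelfDual K)
    (hsal : (K : ConvexCone ℝ H).Salient) (hiso : Isotone K (metricProj K)) :
    IsLatticeCone K := by
  have hc := hK.isClosed
  refine isLatticeCone_of_isSup_zero hsal (R := metricProj K) fun x =>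
    ⟨by simpa [ConeLE] using metricProj_mem hc x, hK.metricProj_sub_mem x, fun w hw hxw => ?_⟩
  have h := hiso x w hxw
  rwa [metricProj_of_mem hc (x := w) (by simpa [ConeLE] using hw)] at h

/-- If x ≤ y, then x - y is polar by self-duality, so P x ≤ P y + P(x - y) = P y. -/
theorem IsSelfDual.isotone_of_subadditive (hK : IsSelfDual K)
    (hsub : Subadditive K (metricProj K)) : Isotone K (metricProj K) := by
  intro x y hxy
  have h₁ : metricProj K (x - y) = 0 := (metricProj_eq_zero_iff hK.isClosed).2 fun z hz => by
    have h := hK.inner_nonneg hxy hz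
    rw [← neg_sub, inner_neg_left] at h
    linarith
  have h₂ := hsub y (x - y)
  rwa [h₁, add_sub_cancel, add_zero] at h₂

/-- A closed salient cone has a dual cone with dense linear span. -/
theorem dense_span_innerDual (hc : IsClosed (K : Set H))
    (hsal : (K : ConvexCone ℝ H).Salient) :
    Dense (Submodule.span ℝ {u : H | ∀ y ∈ K, 0 ≤ ⟪u, y⟫} : Set H) := by
  rw [Submodule.dense_iff_topologicalClosure_eq_top, Submodule.topologicalClosure_eq_top_iff,
    Submodule.eq_bot_iff]
  intro z hz
  -- If z ⊥ K*, then z is orthogonal to `P z - z`, itself in K*; since `P z` is too, z = P z.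
  have hmem : ∀ z : H, (∀ u : H, (∀ y ∈ K, 0 ≤ ⟪u, y⟫) → ⟪u, z⟫ = 0) → z ∈ K := by
    intro z hz
    have h₁ := hz (metricProj K z - z) fun y hy => by
      rw [← neg_sub, inner_neg_left]
      linarith [inner_sub_metricProj_le hc z hy]
    have h₂ := inner_sub_metricProj_self hc z
    have h₃ : ⟪z - metricProj K z, z - metricProj K z⟫ ≤ 0 := by
      rw [← neg_sub, inner_neg_left] at h₁
      rw [inner_sub_right]
      linarith
    rw [sub_eq_zero.1 (real_inner_self_nonpos.1 h₃)]
    exact metricProj_mem hc z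
  have hz' : ∀ u : H, (∀ y ∈ K, 0 ≤ ⟪u, y⟫) → ⟪u, z⟫ = 0 := fun u hu =>
    (Submodule.mem_orthogonal _ z).1 hz u (Submodule.subset_span hu)
  refine eq_of_sub_mem hsal (by simpa using hmem z hz') ?_
  simpa using hmem (-z) fun u hu => by rw [inner_neg_right, hz' u hu, neg_zero]

/-- If `I - P` is subadditive for the polar cone, the cone lies in its dual. -/
theorem inner_nonneg_of_subadditive_polar (hc : IsClosed (K : Set H))
    (hsal : (K : ConvexCone ℝ H).Salient)
    (hsub : ∀ x y z : H, z ∈ K →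
      0 ≤ ⟪metricProj K x + metricProj K y - metricProj K (x + y), z⟫) {x y : H}
    (hx : x ∈ K) (hy : y ∈ K) : 0 ≤ ⟪x, y⟫ := by
  have hzero : ∀ u : H, (∀ y ∈ K, 0 ≤ ⟪u, y⟫) → metricProj K (-u) = 0 := fun u hu =>
    (metricProj_eq_zero_iff hc).2 fun y hy => by
      rw [inner_neg_left]
      linarith [hu y hy]
  have hspan : ∀ w ∈ Submodule.span ℝ {u : H | ∀ y ∈ K, 0 ≤ ⟪u, y⟫},
      ∃ a b : H, (∀ y ∈ K, 0 ≤ ⟪a, y⟫) ∧ (∀ y ∈ K, 0 ≤ ⟪b, y⟫) ∧ w = a - b := by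
    intro w hw
    induction hw using Submodule.span_induction with
    | mem u hu => exact ⟨u, 0, hu, by simp, by simp⟩
    | zero => exact ⟨0, 0, by simp, by simp, by simp⟩
    | add u v _ _ hu hv =>
      obtain ⟨a, b, ha, hb, rfl⟩ := hu
      obtain ⟨c, d, hc', hd, rfl⟩ := hv
      refine ⟨a + c, b + d, fun y hy => ?_, fun y hy => ?_, by abel⟩
      · rw [inner_add_left]
        exact add_nonneg (ha y hy) (hc' y hy)
      · rw [inner_add_left]
        exact add_nonneg (hb y hy) (hd y hy)
    | smul t u _ hu =>
      obtain ⟨a, b, ha, hb, rfl⟩ := hu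
      rcases le_total 0 t with ht | ht
      · refine ⟨t • a, t • b, fun y hy => ?_, fun y hy => ?_, smul_sub _ _ _⟩
        · rw [real_inner_smul_left]
          exact mul_nonneg ht (ha y hy)
        · rw [real_inner_smul_left]
          exact mul_nonneg ht (hb y hy)
      · refine ⟨(-t) • b, (-t) • a, fun y hy => ?_, fun y hy => ?_, by module⟩
        · rw [real_inner_smul_left]
          exact mul_nonneg (neg_nonneg.2 ht) (hb y hy)
        · rw [real_inner_smul_left]
          exact mul_nonneg (neg_nonneg.2 ht) (ha y hy)
  have hclosed : IsClosed {w : H | 0 ≤ ⟪metricProj K w, y⟫} :=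
    isClosed_le continuous_const ((continuous_metricProj hc).inner continuous_const)
  have hall : ∀ w : H, 0 ≤ ⟪metricProj K w, y⟫ := by
    intro w
    refine hclosed.closure_subset_iff.2 ?_ (dense_span_innerDual hc hsal w)
    intro w hw
    obtain ⟨a, b, ha, hb, rfl⟩ := hspan w hw
    -- For a, b in K* the summands a - b and -a add up to -b, and P kills both -a and -b, leaving
    -- only P(a - b).
    have h := hsub (a - b) (-a) y hy
    have hab : a - b + -a = -b := by abel
    rwa [hab, hzero a ha, hzero b hb, add_zero, sub_zero] at h
  simpa [metricProj_of_mem hc hx] using hall x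

/-- The cone range of `I - P` is contained in the polar cone. -/
theorem inner_le_zero_of_mem_range (hc : IsClosed (K : Set H)) {C : PointedCone ℝ H}
    (hC : IsRetractionOnto C fun x => x - metricProj K x) {x y : H} (hx : x ∈ C) (hy : y ∈ K) :
    ⟪x, y⟫ ≤ 0 := by
  have hx' : x ∈ (C : Set H) := hx
  rw [← hC.range_eq] at hx'
  obtain ⟨z, rfl⟩ := hx'
  exact inner_sub_metricProj_le hc z hy

theorem isSelfDual_of_isProperAVn (hc : IsClosed (K : Set H))
    (hsal : (K : ConvexCone ℝ H).Salient) (hgen : (K : ConvexCone ℝ H).IsReproducing)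
    (hP : IsProperAVn K (metricProj K)) {C : PointedCone ℝ H}
    (hC : IsProperAVn C fun x => x - metricProj K x) : IsSelfDual K := by
  refine isSelfDual_iff.2 fun x => ⟨fun hx y hy => ?_, mem_of_subadditive hc hgen hP.subadditive⟩
  refine inner_nonneg_of_subadditive_polar hc hsal (fun x y z hz => ?_) hx hy
  have h := inner_le_zero_of_mem_range hc hC.retraction (hC.subadditive x y) hz
  have h' : x - metricProj K x + (y - metricProj K y) - (x + y - metricProj K (x + y)) =
      -(metricProj K x + metricProj K y - metricProj K (x + y)) := by abel
  rw [h', inner_neg_left] at h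
  linarith

theorem IsSelfDual.isProperAVn (hK : IsSelfDual K) (hL : IsLatticeCone K) :
    IsProperAVn K (metricProj K) where
  salient := hL.salient
  closed := hK.isClosed
  continuous := continuous_metricProj hK.isClosed
  retraction := metricProj_isRetractionOnto hK.isClosed
  pos_homogeneous _ x ht := metricProj_smul hK.isClosed ht x
  subadditive := by
    rw [hK.metricProj_eq_posPart hL]
    exact posPart_subadditive hL
  eq_zero x h₁ h₂ := by
    rw [hK.metricProj_eq_posPart hL] at h₁ h₂
    simpa [posPart_neg hL, h₁] using h₂
  proper := metricProj_sub_self hK.isClosed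

theorem IsSelfDual.exists_isProperAVn_sub (hK : IsSelfDual K) (hL : IsLatticeCone K) :
    ∃ C : PointedCone ℝ H, IsProperAVn C fun x => x - metricProj K x := by
  have h : (fun x => x - metricProj K x) = fun x => -metricProj K (-x) := by
    funext x
    rw [hK.metricProj_eq_posPart hL, posPart_neg hL, neg_sub]
  exact ⟨_, h ▸ (hK.isProperAVn hL).neg⟩

end Projection

/-! ### Orthogonal generators in finite dimension -/

section FiniteDimensional

variable {K : PointedCone ℝ H}

/-- A finite set of nonzero pairwise orthogonal elements of the cone `K`. -/
structure IsOrthogonalIn (K : PointedCone ℝ H) (S : Finset H) : Prop where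
  mem : ∀ v ∈ S, v ∈ K
  ne_zero : ∀ v ∈ S, v ≠ 0
  orthogonal : ∀ v ∈ S, ∀ w ∈ S, v ≠ w → ⟪v, w⟫ = 0

theorem IsOrthogonalIn.linearIndependent {S : Finset H} (hS : IsOrthogonalIn K S) :
    LinearIndependent ℝ ((↑) : S → H) :=
  linearIndependent_of_ne_zero_of_inner_eq_zero (fun v => hS.ne_zero v v.2)
    fun v w hvw => hS.orthogonal v v.2 w w.2 (Subtype.coe_injective.ne hvw)

open Classical in
theorem IsOrthogonalIn.insert {S : Finset H} (hS : IsOrthogonalIn K S) {z : H} (hz : z ∈ K)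
    (hz₀ : z ≠ 0) (horth : ∀ v ∈ S, ⟪z, v⟫ = 0) : IsOrthogonalIn K (insert z S) := by
  refine ⟨?_, ?_, ?_⟩
  · simpa [hz] using hS.mem
  · intro v hv
    rcases Finset.mem_insert.1 hv with rfl | hv
    · exact hz₀
    · exact hS.ne_zero v hv
  · intro v hv w hw hne
    rcases Finset.mem_insert.1 hv with hv | hv <;> rcases Finset.mem_insert.1 hw with hw | hw
    · exact absurd (hv.trans hw.symm) hne
    · exact hv ▸ horth w hw
    · rw [real_inner_comm, hw]
      exact horth v hv
    · exact hS.orthogonal v hv w hw hne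

theorem notMem_of_orthogonal {S : Finset H} {z : H} (hz₀ : z ≠ 0)
    (horth : ∀ v ∈ S, ⟪z, v⟫ = 0) : z ∉ S := fun h => hz₀ (inner_self_eq_zero.1 (horth z h))

/-- An orthogonal set of largest possible size. -/
structure IsMaxOrthogonalIn (K : PointedCone ℝ H) (S : Finset H) : Prop
    extends IsOrthogonalIn K S where
  card_le : ∀ T : Finset H, IsOrthogonalIn K T → T.card ≤ S.card

/-- Linear independence bounds the size. Maximality in cardinality, not merely under inclusion, is
what forbids replacing one vector by two. -/
theorem exists_isMaxOrthogonalIn [FiniteDimensional ℝ H] (K : PointedCone ℝ H) :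
    ∃ S : Finset H, IsMaxOrthogonalIn K S := by
  classical
  let p : ℕ → Prop := fun k => ∃ S : Finset H, IsOrthogonalIn K S ∧ S.card = k
  have hbound : ∀ T : Finset H, IsOrthogonalIn K T → T.card ≤ Module.finrank ℝ H := fun T hT => by
    simpa using hT.linearIndependent.fintype_card_le_finrank
  have h₀ : p 0 := ⟨∅, ⟨by simp, by simp, by simp⟩, rfl⟩
  obtain ⟨S, hS, hcard⟩ := Nat.findGreatest_spec (P := p) (Nat.zero_le (Module.finrank ℝ H)) h₀
  refine ⟨S, hS, fun T hT => ?_⟩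
  rw [hcard]
  exact Nat.le_findGreatest (hbound T hT) ⟨T, hT, rfl⟩

theorem IsMaxOrthogonalIn.eq_zero {S : Finset H} (hS : IsMaxOrthogonalIn K S) {z : H}
    (hz : z ∈ K) (horth : ∀ v ∈ S, ⟪z, v⟫ = 0) : z = 0 := by
  classical
  by_contra hz₀
  have h := hS.card_le _ (hS.toIsOrthogonalIn.insert hz hz₀ horth)
  rw [Finset.card_insert_of_notMem (notMem_of_orthogonal hz₀ horth)] at h
  omega

/-- No element of a maximal orthogonal set can be replaced by two. -/
theorem IsMaxOrthogonalIn.not_replace {S : Finset H} (hS : IsMaxOrthogonalIn K S) {v a b : H}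
    (hv : v ∈ S) (ha : a ∈ K) (hb : b ∈ K) (hab : ⟪a, b⟫ = 0)
    (haS : ∀ w ∈ S, w ≠ v → ⟪a, w⟫ = 0) (hbS : ∀ w ∈ S, w ≠ v → ⟪b, w⟫ = 0) :
    a = 0 ∨ b = 0 := by
  classical
  by_contra! hne
  obtain ⟨ha₀, hb₀⟩ := hne
  have hE : IsOrthogonalIn K (S.erase v) :=
    ⟨fun w hw => hS.mem w (Finset.mem_of_mem_erase hw),
      fun w hw => hS.ne_zero w (Finset.mem_of_mem_erase hw),
      fun w hw u hu => hS.orthogonal w (Finset.mem_of_mem_erase hw) u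
        (Finset.mem_of_mem_erase hu)⟩
  have hb' : ∀ w ∈ S.erase v, ⟪b, w⟫ = 0 := fun w hw =>
    hbS w (Finset.mem_of_mem_erase hw) (Finset.ne_of_mem_erase hw)
  have ha' : ∀ w ∈ Insert.insert b (S.erase v), ⟪a, w⟫ = 0 := by
    intro w hw
    rcases Finset.mem_insert.1 hw with rfl | hw
    · exact hab
    · exact haS w (Finset.mem_of_mem_erase hw) (Finset.ne_of_mem_erase hw)
  have h := hS.card_le _ ((hE.insert hb hb₀ hb').insert ha ha₀ ha')
  rw [Finset.card_insert_of_notMem (notMem_of_orthogonal ha₀ ha'),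
    Finset.card_insert_of_notMem (notMem_of_orthogonal hb₀ hb')] at h
  have := Finset.card_erase_add_one hv
  omega

theorem inner_sub_proj_eq_zero {x v : H} (hv : v ≠ 0) :
    ⟪x - (⟪x, v⟫ / ⟪v, v⟫) • v, v⟫ = 0 := by
  have h : ⟪v, v⟫ ≠ 0 := inner_self_ne_zero.2 hv
  rw [inner_sub_left, real_inner_smul_left, div_mul_cancel₀ _ h, sub_self]

variable [CompleteSpace H]

/-- An element dominated by one orthogonal to `w` is orthogonal to `w`. -/
theorem IsSelfDual.inner_eq_zero_of_le (hK : IsSelfDual K) {u v w : H} (hu : u ∈ K) (hw : w ∈ K)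
    (huv : v - u ∈ K) (hvw : ⟪v, w⟫ = 0) : ⟪u, w⟫ = 0 := by
  have h₁ := hK.inner_nonneg hu hw
  have h₂ := hK.inner_nonneg huv hw
  rw [inner_sub_left] at h₂
  linarith

/-- The elements of a maximal orthogonal set generate extreme rays. -/
theorem IsMaxOrthogonalIn.eq_smul_of_le {S : Finset H} (hS : IsMaxOrthogonalIn K S)
    (hK : IsSelfDual K) (hL : IsLatticeCone K) {v u : H} (hv : v ∈ S) (hu : u ∈ K) {t : ℝ}
    (hut : t • v - u ∈ K) : ∃ s : ℝ, u = s • v := by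
  have hvK := hS.mem v hv
  set c : ℝ := ⟪u, v⟫ / ⟪v, v⟫ with hc
  have hc₀ : 0 ≤ c := div_nonneg (hK.inner_nonneg hu hvK) real_inner_self_nonneg
  have hcv : c • v ∈ K := K.smul_mem hc₀ hvK
  have hwv : ⟪u - c • v, v⟫ = 0 := inner_sub_proj_eq_zero (hS.ne_zero v hv)
  -- Here w ⊥ v, while w⁺ ≤ u ≤ t v and w⁻ ≤ c v. Both parts are thus orthogonal to the other
  -- members of S and to each other, so one of them vanishes.
  set w := u - c • v with hw
  have hp := posPart_mem hL w
  have hq := posPart_sub_mem hL w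
  have hpu : u - posPart K w ∈ K := sub_posPart_mem hL hu (by simpa [hw] using hcv)
  have hpt : t • v - posPart K w ∈ K := by
    convert K.add_mem hut hpu using 1
    abel
  have hqc : c • v - (posPart K w - w) ∈ K := by
    convert hpu using 1
    rw [hw]
    abel
  have horth : ∀ r : ℝ, ∀ a ∈ K, r • v - a ∈ K → ∀ z ∈ S, z ≠ v → ⟪a, z⟫ = 0 :=
    fun r a ha har z hz hne => hK.inner_eq_zero_of_le ha (hS.mem z hz) har
      (by rw [real_inner_smul_left, hS.orthogonal v hv z hz hne.symm, mul_zero])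
  refine ⟨c, sub_eq_zero.1 ?_⟩
  rw [← hw]
  -- In either case w or -w lies in K below a multiple of v to which it is orthogonal, hence is
  -- zero.
  rcases hS.not_replace hv hp hq (hK.inner_posPart hL w) (horth t _ hp hpt) (horth c _ hq hqc)
    with h | h
  · rw [h, zero_sub] at hq hqc
    refine neg_eq_zero.1 (hK.eq_zero_of_le hq hq (by simp) hqc ?_)
    rw [inner_smul_right, inner_neg_left, hwv]
    simp
  · have hpw := sub_eq_zero.1 h
    rw [hpw] at hp hpt
    refine hK.eq_zero_of_le hp hp (by simp) hpt ?_
    rw [inner_smul_right, hwv, mul_zero]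

/-- With w the remainder, w⁻ ≤ c v, so extremality makes w⁻ a multiple of v and thus orthogonal to
w. Being orthogonal to w⁺ as well, it is zero. -/
theorem IsMaxOrthogonalIn.sub_proj_mem {S : Finset H} (hS : IsMaxOrthogonalIn K S)
    (hK : IsSelfDual K) (hL : IsLatticeCone K) {v x : H} (hv : v ∈ S) (hx : x ∈ K) :
    x - (⟪x, v⟫ / ⟪v, v⟫) • v ∈ K := by
  have hvK := hS.mem v hv
  have hv₀ := hS.ne_zero v hv
  set c : ℝ := ⟪x, v⟫ / ⟪v, v⟫ with hc
  have hc₀ : 0 ≤ c := div_nonneg (hK.inner_nonneg hx hvK) real_inner_self_nonneg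
  have hcv : c • v ∈ K := K.smul_mem hc₀ hvK
  have hwv : ⟪x - c • v, v⟫ = 0 := inner_sub_proj_eq_zero hv₀
  set w := x - c • v with hw
  have hpx : x - posPart K w ∈ K := sub_posPart_mem hL hx (by simpa [hw] using hcv)
  obtain ⟨s, hs⟩ := hS.eq_smul_of_le hK hL hv (posPart_sub_mem hL w) (t := c) (by
    convert hpx using 1
    rw [hw]
    abel)
  have horth := hK.inner_posPart hL w
  have hzero : posPart K w - w = 0 := by
    have h : ⟪posPart K w - w, posPart K w - w⟫ = 0 := by
      conv_lhs => rw [inner_sub_left, horth, zero_sub]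
      rw [hs, inner_smul_right, hwv, mul_zero, neg_zero]
    exact inner_self_eq_zero.1 h
  rw [← sub_eq_zero.1 hzero]
  exact posPart_mem hL w

/-- Projections are removed one at a time; by orthogonality earlier removals do not change later
coefficients. -/
theorem IsMaxOrthogonalIn.eq_sum {S : Finset H} (hS : IsMaxOrthogonalIn K S)
    (hK : IsSelfDual K) (hL : IsLatticeCone K) {x : H} (hx : x ∈ K) :
    x = ∑ v ∈ S, (⟪x, v⟫ / ⟪v, v⟫) • v := by
  classical
  have horth : ∀ T ⊆ S, ∀ w ∈ S,
      ⟪∑ v ∈ T, (⟪x, v⟫ / ⟪v, v⟫) • v, w⟫ = if w ∈ T then ⟪x, w⟫ else 0 := by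
    intro T hT w hw
    rw [sum_inner]
    split_ifs with hwT
    · rw [Finset.sum_eq_single_of_mem w hwT, real_inner_smul_left,
        div_mul_cancel₀ _ (inner_self_ne_zero.2 (hS.ne_zero w hw))]
      intro v hv hne
      rw [real_inner_smul_left, hS.orthogonal v (hT hv) w hw hne, mul_zero]
    · refine Finset.sum_eq_zero fun v hv => ?_
      rw [real_inner_smul_left, hS.orthogonal v (hT hv) w hw (fun h => hwT (h ▸ hv)), mul_zero]
  have hmem : ∀ T ⊆ S, x - ∑ v ∈ T, (⟪x, v⟫ / ⟪v, v⟫) • v ∈ K := by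
    intro T
    induction T using Finset.induction_on with
    | empty => simpa using hx
    | insert w T hwT ih =>
      intro hT
      have hwS := hT (Finset.mem_insert_self w T)
      have hTS := (Finset.subset_insert w T).trans hT
      have h := hS.sub_proj_mem hK hL hwS (ih hTS)
      rw [inner_sub_left, horth T hTS w hwS, if_neg hwT, sub_zero] at h
      rw [Finset.sum_insert hwT]
      convert h using 1
      abel
  refine sub_eq_zero.1 (hS.eq_zero (hmem S subset_rfl) fun w hw => ?_)
  rw [inner_sub_left, horth S subset_rfl w hw, if_pos hw, sub_self]

theorem IsSelfDual.isOrthogonallyGenerated (hK : IsSelfDual K) (hL : IsLatticeCone K)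
    (hgen : (K : ConvexCone ℝ H).IsReproducing) {m : ℕ}
    (hm : Module.rank ℝ H = (m : Cardinal)) : IsOrthogonallyGenerated K m := by
  have : FiniteDimensional ℝ H := Module.rank_lt_aleph0_iff.1 (hm ▸ Cardinal.natCast_lt_aleph0)
  obtain ⟨S, hS⟩ := exists_isMaxOrthogonalIn K
  have hspanK : ∀ x ∈ K, x ∈ Submodule.span ℝ (S : Set H) := by
    intro x hx
    rw [hS.eq_sum hK hL hx]
    exact Submodule.sum_mem _ fun v hv => Submodule.smul_mem _ _ (Submodule.subset_span hv)
  have hspan : Submodule.span ℝ (S : Set H) = ⊤ := by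
    refine (Submodule.eq_top_iff').2 fun x => ?_
    have h : x ∈ (Set.univ : Set H) := Set.mem_univ x
    rw [← hgen.sub_eq_univ] at h
    obtain ⟨a, ha, b, hb, rfl⟩ := h
    exact Submodule.sub_mem _ (hspanK a ha) (hspanK b hb)
  have hli := hS.linearIndependent
  have hcard : S.card = m := by
    rw [← finrank_span_finset_eq_card hli, hspan, finrank_top]
    exact Module.finrank_eq_of_rank_eq hm
  let e : Fin m ≃ S := (S.equivFinOfCardEq hcard).symm
  refine ⟨fun i => e i, hli.comp e e.injective, fun i j hij => ?_, ?_⟩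
  · exact hS.orthogonal _ (e i).2 _ (e j).2 (Subtype.coe_injective.ne (e.injective.ne hij))
  · refine Set.Subset.antisymm (fun x hx => ?_) ?_
    · refine ⟨fun i => ⟪x, (e i : H)⟫ / ⟪(e i : H), (e i : H)⟫, fun i =>
        div_nonneg (hK.inner_nonneg hx (hS.mem _ (e i).2)) real_inner_self_nonneg, ?_⟩
      rw [e.sum_comp fun v : S => (⟪x, (v : H)⟫ / ⟪(v : H), (v : H)⟫) • (v : H),
        Finset.sum_coe_sort S fun v : H => (⟪x, v⟫ / ⟪v, v⟫) • v]
      exact hS.eq_sum hK hL hx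
    · rintro _ ⟨t, ht, rfl⟩
      exact K.sum_mem fun i _ => K.smul_mem (ht i) (hS.mem _ (e i).2)

/-- In the orthogonal basis, K is the positive orthant and the inner product is diagonal with
positive entries. Self-duality and suprema can then be read off coordinatewise. -/
theorem IsOrthogonallyGenerated.isHilbertVectorLattice
    (hsal : (K : ConvexCone ℝ H).Salient) {m : ℕ} (hm : Module.rank ℝ H = (m : Cardinal))
    (h : IsOrthogonallyGenerated K m) : IsHilbertVectorLattice K := by
  obtain ⟨v, hli, horth, hKv⟩ := h
  have : FiniteDimensional ℝ H := Module.rank_lt_aleph0_iff.1 (hm ▸ Cardinal.natCast_lt_aleph0)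
  have hmem : ∀ x, x ∈ K ↔ ∃ t : Fin m → ℝ, (∀ i, 0 ≤ t i) ∧ x = ∑ i, t i • v i :=
    Set.ext_iff.1 hKv
  have hvv : ∀ i, 0 < ⟪v i, v i⟫ := fun i => real_inner_self_pos.2 (hli.ne_zero i)
  have hspan : ∀ x : H, ∃ t : Fin m → ℝ, x = ∑ i, t i • v i := by
    intro x
    have htop : Submodule.span ℝ (Set.range v) = ⊤ :=
      hli.span_eq_top_of_card_eq_finrank' (by simp [Module.finrank_eq_of_rank_eq hm])
    have hx : x ∈ Submodule.span ℝ (Set.range v) := htop ▸ Submodule.mem_top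
    obtain ⟨t, ht⟩ := (Submodule.mem_span_range_iff_exists_fun ℝ).1 hx
    exact ⟨t, ht.symm⟩
  have hinner : ∀ (t : Fin m → ℝ) j, ⟪∑ i, t i • v i, v j⟫ = t j * ⟪v j, v j⟫ := by
    intro t j
    rw [sum_inner, Finset.sum_eq_single j, real_inner_smul_left]
    · intro i _ hij
      rw [real_inner_smul_left, horth i j hij, mul_zero]
    · simp
  have hmem' : ∀ t : Fin m → ℝ, ∑ i, t i • v i ∈ K ↔ ∀ i, 0 ≤ t i := by
    refine fun t => ⟨fun ht j => ?_, fun ht => (hmem _).2 ⟨t, ht, rfl⟩⟩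
    obtain ⟨s, hs, hst⟩ := (hmem _).1 ht
    have h := hinner t j
    rw [hst, hinner] at h
    rw [← mul_right_cancel₀ (hvv j).ne' h]
    exact hs j
  have hvK : ∀ i, v i ∈ K := fun i => by
    rw [hmem]
    exact ⟨Pi.single i 1, fun j => by by_cases h : j = i <;> simp [h],
      by simp [Pi.single_apply]⟩
  have hdual : IsSelfDual K := by
    refine isSelfDual_iff.2 fun x => ⟨fun hx y hy => ?_, fun hx => ?_⟩
    · obtain ⟨s, rfl⟩ := hspan x
      obtain ⟨t, rfl⟩ := hspan y
      rw [inner_sum]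
      refine Finset.sum_nonneg fun i _ => ?_
      rw [real_inner_smul_right, hinner]
      exact mul_nonneg ((hmem' t).1 hy i) (mul_nonneg ((hmem' s).1 hx i) (hvv i).le)
    · obtain ⟨s, rfl⟩ := hspan x
      refine (hmem' s).2 fun i => ?_
      have h := hx (v i) (hvK i)
      rw [hinner] at h
      exact nonneg_of_mul_nonneg_left h (hvv i)
  have hsup : ∀ x, ∃ s, IsSup K 0 x s := by
    intro x
    obtain ⟨a, rfl⟩ := hspan x
    refine ⟨∑ i, max 0 (a i) • v i, ?_, ?_, fun w hw haw => ?_⟩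
    · simp [ConeLE, hmem']
    · unfold ConeLE
      rw [← Finset.sum_sub_distrib]
      simp_rw [← sub_smul]
      exact (hmem' _).2 fun i => sub_nonneg.2 (le_max_right _ _)
    · obtain ⟨b, rfl⟩ := hspan w
      unfold ConeLE at *
      rw [← Finset.sum_sub_distrib] at haw ⊢
      simp_rw [← sub_smul] at haw ⊢
      rw [sub_zero] at hw
      exact (hmem' _).2 fun i => sub_nonneg.2
        (max_le ((hmem' b).1 hw i) (sub_nonneg.1 ((hmem' _).1 haw i)))
  choose R hR using hsup
  exact hdual.isHilbertVectorLattice (isLatticeCone_of_isSup_zero hsal hR)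

end FiniteDimensional

end ConeOrdered

/-! ### Equivalence of the assertions -/

theorem mainTheorem4 {H : Type*} [NormedAddCommGroup H] [InnerProductSpace ℝ H]
    [CompleteSpace H] [TopologicalSpace.SeparableSpace H]
    (K : PointedCone ℝ H)
    (hgen : (K : ConvexCone ℝ H).IsReproducing)
    (hnormal : ConeOrdered.IsNormalCone K) :
    List.TFAE [
      ConeOrdered.IsProperAVn K (ConeOrdered.metricProj K) ∧
        ∃ C : PointedCone ℝ H,
          ConeOrdered.IsProperAVn C (fun x => x - ConeOrdered.metricProj K x),
      ConeOrdered.IsRetractionOnto K (ConeOrdered.metricProj K) ∧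
        ConeOrdered.Subadditive K (ConeOrdered.metricProj K) ∧
        ConeOrdered.Isotone K (ConeOrdered.metricProj K),
      ConeOrdered.IsHilbertVectorLattice K,
      ConeOrdered.IsSelfDual K ∧ ConeOrdered.IsLatticeCone K,
      ConeOrdered.IsLatticeCone K ∧ ConeOrdered.metricProj K = ConeOrdered.posPart K] ∧
    ∀ m : ℕ, Module.rank ℝ H = (m : Cardinal) →
      (ConeOrdered.IsHilbertVectorLattice K ↔ ConeOrdered.IsOrthogonallyGenerated K m) := by
  have hc := hnormal.closed
  have hsal := hnormal.salient
  refine ⟨?_, fun m hm => ⟨fun h => h.isSelfDual.isOrthogonallyGenerated h.lattice hgen hm,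
    fun h => h.isHilbertVectorLattice hsal hm⟩⟩
  tfae_have 1 → 2 := by
    rintro ⟨hP, C, hC⟩
    exact ⟨hP.retraction, hP.subadditive,
      (ConeOrdered.isSelfDual_of_isProperAVn hc hsal hgen hP hC).isotone_of_subadditive
        hP.subadditive⟩
  tfae_have 2 → 4 := by
    rintro ⟨-, hsub, hiso⟩
    have hK := ConeOrdered.isSelfDual_of_subadditive_of_isotone hc hgen hsub hsal hiso
    exact ⟨hK, hK.isLatticeCone_of_isotone hsal hiso⟩
  tfae_have 4 → 1 := fun h => ⟨h.1.isProperAVn h.2, h.1.exists_isProperAVn_sub h.2⟩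
  tfae_have 4 → 3 := fun h => h.1.isHilbertVectorLattice h.2
  tfae_have 3 → 4 := fun h => ⟨h.isSelfDual, h.lattice⟩
  tfae_have 4 → 5 := fun h => ⟨h.2, h.1.metricProj_eq_posPart h.2⟩
  tfae_have 5 → 4 := fun h =>
    ⟨ConeOrdered.isSelfDual_of_metricProj_eq_posPart hc h.1 h.2, h.1⟩
  tfae_finish
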